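/- For a finite-dimensional complex Hilbert space $\mathrm{H}$, write $|\mathrm{H}|$ for its dimension, $\mathcal{L}(\mathrm{H})$ for the linear operators on $\mathrm{H}$, $\mathcal{D}(\mathrm{H})\subset\mathcal{L}(\mathrm{H})$ for the density operators (positive semi-definite, trace $1$), and $\|\cdot\|_\infty$ for the operator norm. The Kraus rank of a completely positive (CP) map $\mathcal{M}:\mathcal{L}(\mathrm{A})\to\mathcal{L}(\mathrm{B})$ is the least $s\in\mathbb{N}$ such that $\mathcal{M}(X)=\sum_{i=1}^{s}K_iXK_i^{\dagger}$ for all $X\in\mathcal{L}(\mathrm{A})$, for some linear operators $K_1,\dots,K_s:\mathrm{A}\to\mathrm{B}$. **Theorem.** There is a universal constant $C>0$ such that the following holds. Let $\mathrm{A}$, $\mathrm{B}$ be finite-dimensional complex Hilbert spaces, let $0<\varepsilon<1$, and let $\mathcal{N}:\mathcal{L}(\mathrm{A})\to\mathcal{L}(\mathrm{B})$ be a completely positive and trace-preserving linear map whose Kraus rank is at least $\max(|\mathrm{A}|,|\mathrm{B}|)$. Then there exists a CP map $\widehat{\mathcal{N}}:\mathcal{L}(\mathrm{A})\to\mathcal{L}(\mathrm{B})$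 with Kraus rank at most $C\max(|\mathrm{A}|,|\mathrm{B}|)/\varepsilon^2$ such that $$\sup_{\varrho\in\mathcal{D}(\mathrm{A})}\bigl\|\widehat{\mathcal{N}}(\varrho)-\mathcal{N}(\varrho)\bigr\|_{\infty}\le\varepsilon\,\sup_{\varrho\in\mathcal{D}(\mathrm{A})}\bigl\|\mathcal{N}(\varrho)\bigr\|_{\infty}.$$ -/

import Mathlib

universe u v

/-- The density operators on a finite-dimensional complex Hilbert space `H`: the positive
semi-definite operators of trace one. -/
def densityOperators (H : Type*) [NormedAddCommGroup H] [InnerProductSpace ℂ H] :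
    Set (H →L[ℂ] H) :=
  {ρ | ρ.IsPositive ∧ LinearMap.trace ℂ H (ρ : H →ₗ[ℂ] H) = 1}

/-- A map between operator spaces preserves the trace. -/
def IsTracePreserving {A B : Type*}
    [NormedAddCommGroup A] [InnerProductSpace ℂ A]
    [NormedAddCommGroup B] [InnerProductSpace ℂ B]
    (Φ : (A →L[ℂ] A) →ₗ[ℂ] (B →L[ℂ] B)) : Prop :=
  ∀ X : A →L[ℂ] A,
    LinearMap.trace ℂ B (Φ X : B →ₗ[ℂ] B) = LinearMap.trace ℂ A (X : A →ₗ[ℂ] A)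

/-- `Φ` can be written as `X ↦ ∑ i, K i X (K i)†` with `s` operators `K i : A → B`. -/
def HasKrausForm {A B : Type*}
    [NormedAddCommGroup A] [InnerProductSpace ℂ A] [CompleteSpace A]
    [NormedAddCommGroup B] [InnerProductSpace ℂ B] [CompleteSpace B]
    (Φ : (A →L[ℂ] A) →ₗ[ℂ] (B →L[ℂ] B)) (s : ℕ) : Prop :=
  ∃ K : Fin s → (A →L[ℂ] B), ∀ X : A →L[ℂ] A,
    Φ X = ∑ i, K i ∘L X ∘L ContinuousLinearMap.adjoint (K i)

/-- The Kraus rank: the least number of operators in a Kraus form of `Φ`. It is used for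
completely positive maps between finite-dimensional spaces, which always have a Kraus form. -/
noncomputable def krausRank {A B : Type*}
    [NormedAddCommGroup A] [InnerProductSpace ℂ A] [CompleteSpace A]
    [NormedAddCommGroup B] [InnerProductSpace ℂ B] [CompleteSpace B]
    (Φ : (A →L[ℂ] A) →ₗ[ℂ] (B →L[ℂ] B)) : ℕ :=
  sInf {s : ℕ | HasKrausForm Φ s}

/-- The supremum of the operator norm `‖Φ ρ‖` over all density operators `ρ`. -/
noncomputable def supOpNorm {A B : Type*}
    [NormedAddCommGroup A] [InnerProductSpace ℂ A]
    [NormedAddCommGroup B] [InnerProductSpace ℂ B]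
    (Φ : (A →L[ℂ] A) →ₗ[ℂ] (B →L[ℂ] B)) : ℝ :=
  ⨆ ρ : densityOperators A, ‖Φ ρ‖

/-- In finite dimension a density operator has operator norm at most one. -/
theorem norm_le_one_of_mem_densityOperators {A : Type*}
    [NormedAddCommGroup A] [InnerProductSpace ℂ A] [FiniteDimensional ℂ A] [CompleteSpace A]
    {ρ : A →L[ℂ] A} (h : ρ ∈ densityOperators A) : ‖ρ‖ ≤ 1 := by
  obtain ⟨hp, ht⟩ := h
  have h0 : (0 : A →L[ℂ] A) ≤ ρ := (ContinuousLinearMap.nonneg_iff_isPositive ρ).2 hp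
  obtain ⟨S, rfl⟩ := CStarAlgebra.nonneg_iff_eq_star_mul_self.1 h0
  let b := stdOrthonormalBasis ℂ A
  rw [LinearMap.trace_eq_sum_inner _ b] at ht
  have hs : ∑ i, ‖S (b i)‖ ^ 2 = 1 := by
    have : ∀ i, inner ℂ (b i) ((star S * S : A →L[ℂ] A) (b i)) = ((‖S (b i)‖ ^ 2 : ℝ) : ℂ) := by
      intro i
      rw [ContinuousLinearMap.star_eq_adjoint, mul_apply_eq_comp,
        ContinuousLinearMap.adjoint_inner_right, inner_self_eq_norm_sq_to_K]
      norm_cast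
    simp only [ContinuousLinearMap.coe_coe, this] at ht
    exact_mod_cast ht
  rw [CStarRing.norm_star_mul_self, ← sq]
  have hS : ‖S‖ ≤ 1 := by
    refine S.opNorm_le_bound zero_le_one fun x => ?_
    have hx : S x = ∑ i, inner ℂ (b i) x • S (b i) := by
      conv_lhs => rw [← b.sum_repr' x]
      simp
    have h1 : ‖S x‖ ≤ ∑ i, ‖inner ℂ (b i) x‖ * ‖S (b i)‖ := by
      rw [hx]
      exact (norm_sum_le _ _).trans (le_of_eq (by simp [norm_smul]))
    have h2 := Finset.sum_mul_sq_le_sq_mul_sq Finset.univ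
      (fun i => ‖inner ℂ (b i) x‖) (fun i => ‖S (b i)‖)
    rw [hs, b.sum_sq_norm_inner_right, mul_one] at h2
    rw [one_mul]
    exact h1.trans ((le_abs_self _).trans (abs_le_of_sq_le_sq h2 (norm_nonneg x)))
  nlinarith [norm_nonneg S]

/-- The supremum in `supOpNorm` is over a bounded set of reals. -/
theorem bddAbove_supOpNorm {A B : Type*}
    [NormedAddCommGroup A] [InnerProductSpace ℂ A] [FiniteDimensional ℂ A] [CompleteSpace A]
    [NormedAddCommGroup B] [InnerProductSpace ℂ B]
    (Φ : (A →L[ℂ] A) →ₗ[ℂ] (B →L[ℂ] B)) :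
    BddAbove (Set.range fun ρ : densityOperators A => ‖Φ ρ‖) := by
  refine ⟨‖LinearMap.toContinuousLinearMap Φ‖, ?_⟩
  rintro _ ⟨ρ, rfl⟩
  have h := (LinearMap.toContinuousLinearMap Φ).le_opNorm (ρ : A →L[ℂ] A)
  have h1 := norm_le_one_of_mem_densityOperators ρ.2
  refine h.trans ?_
  nlinarith [norm_nonneg (LinearMap.toContinuousLinearMap Φ)]

/-! The proof replaces the Kraus operators `K j` of the channel by `n` random combinations `n^(-1/2)
∑ j, ± K j` with independent uniform signs. Averaged over the signs, the new map equals the old one.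
For fixed `x`, `y`, the real and imaginary parts of `⟨y, K j x⟩` give Rademacher sums, whose squares
are subexponential. Bernstein's method then shows that `krausForm` at `(x, y)` has relative error
above `ε` on a fraction of sign patterns at most exponentially small in `n * ε ^ 2`
(`exists_signs_krausForm`). A union bound over nets of the two unit balls, whose sizes are
exponential in the dimensions, is affordable once `n` is of order `max(|A|, |B|) / ε ^ 2`. Control
on the nets passes to operator norms by using the net bound twice, once in `A` and once in `B`
(`norm_krausMap_sub_rankOne_le`); convexity then covers all density operators. Choi's theorem
(`exists_eq_krausMap`) supplies the initial operators, and `krausCPMap` makes the sampled map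
completely positive. Probability appears only as counting: a sum over all sign patterns smaller than
their number yields a good pattern. -/

/-! ### Concentration of squared Rademacher sums, by counting sign patterns. -/

section RandomSigns

open Finset

/-- The sign `±1` encoded by a Boolean. -/
def boolSign (b : Bool) : ℝ := if b then 1 else -1

/-- Averaging out one sign produces `cosh (2μxa) ≤ exp (2μ²x²a²)`, and `μ ≤ 1/4` turns `2μ²` into at
most `1/8`. This is the inductive step for `sum_exp_sq_le`: each sign raises the coefficient of `x ^
2` by `a ^ 2 / 8`. -/
lemma sum_bool_exp_sq_le {μ : ℝ} (hμ₀ : 0 ≤ μ) (hμ : μ ≤ 1 / 4) (x a : ℝ) :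
    ∑ b : Bool, Real.exp (μ * (x + boolSign b * a) ^ 2) ≤
      2 * Real.exp (a ^ 2 / 4 + (μ + a ^ 2 / 8) * x ^ 2) := by
  have h1 : ∑ b : Bool, Real.exp (μ * (x + boolSign b * a) ^ 2) =
      2 * (Real.exp (μ * x ^ 2 + μ * a ^ 2) * Real.cosh (2 * μ * x * a)) := by
    rw [Fintype.sum_bool, Real.cosh_eq]
    simp only [boolSign, if_true, Bool.false_eq_true, if_false]
    rw [mul_div_assoc', mul_add, ← Real.exp_add, ← Real.exp_add, mul_div_cancel₀ _ two_ne_zero]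
    congr 2 <;> ring
  rw [h1]
  refine mul_le_mul_of_nonneg_left ?_ zero_le_two
  refine (mul_le_mul_of_nonneg_left (Real.cosh_le_exp_half_sq _) (Real.exp_pos _).le).trans ?_
  rw [← Real.exp_add]
  refine Real.exp_le_exp.2 ?_
  have h2 : μ * a ^ 2 ≤ 1 / 4 * a ^ 2 := mul_le_mul_of_nonneg_right hμ (sq_nonneg a)
  have h3 : μ * μ * (x * a) ^ 2 ≤ 1 / 4 * (1 / 4) * (x * a) ^ 2 :=
    mul_le_mul_of_nonneg_right (mul_le_mul hμ hμ hμ₀ (by norm_num)) (sq_nonneg _)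
  nlinarith

lemma sum_fin_succ_bool {r : ℕ} (F : (Fin (r + 1) → Bool) → ℝ) :
    ∑ σ, F σ = ∑ b : Bool, ∑ σ : Fin r → Bool, F (Fin.cons b σ) := by
  rw [← Fintype.sum_prod_type', ← (Fin.consEquiv fun _ : Fin (r + 1) => Bool).sum_comp]
  rfl

/-- Rademacher sums are subgaussian: exponential moment of the square. -/
lemma sum_exp_sq_le {r : ℕ} (a : Fin r → ℝ) {μ : ℝ} (hμ₀ : 0 ≤ μ)
    (hμ : μ + (∑ j, a j ^ 2) / 8 ≤ 1 / 4) (x : ℝ) :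
    ∑ σ : Fin r → Bool, Real.exp (μ * (x + ∑ j, boolSign (σ j) * a j) ^ 2) ≤
      2 ^ r * Real.exp ((∑ j, a j ^ 2) / 4 + (μ + (∑ j, a j ^ 2) / 8) * x ^ 2) := by
  induction r generalizing x with
  | zero => simp
  | succ r ih =>
    rw [Fin.sum_univ_succ] at hμ
    set q := ∑ j : Fin r, a j.succ ^ 2 with hq
    have hq0 : 0 ≤ q := sum_nonneg fun j _ => sq_nonneg _
    have ha0 := sq_nonneg (a 0)
    have ih' := fun y => ih (fun j => a j.succ) (by rw [← hq]; linarith) y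
    rw [sum_fin_succ_bool]
    simp only [Fin.sum_univ_succ, Fin.cons_zero, Fin.cons_succ, ← add_assoc, ← hq] at ih' ⊢
    calc _ ≤ ∑ b : Bool, 2 ^ r * Real.exp (q / 4 + (μ + q / 8) * (x + boolSign b * a 0) ^ 2) :=
          sum_le_sum fun b _ => ih' _
      _ = 2 ^ r * Real.exp (q / 4) *
            ∑ b : Bool, Real.exp ((μ + q / 8) * (x + boolSign b * a 0) ^ 2) := by
          rw [mul_sum]
          exact sum_congr rfl fun b _ => by rw [Real.exp_add]; ring
      _ ≤ 2 ^ r * Real.exp (q / 4) *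
            (2 * Real.exp (a 0 ^ 2 / 4 + (μ + q / 8 + a 0 ^ 2 / 8) * x ^ 2)) := by
          refine mul_le_mul_of_nonneg_left (sum_bool_exp_sq_le ?_ ?_ _ _) (by positivity)
          · positivity
          · linarith
      _ = _ := by
          rw [mul_mul_mul_comm, ← Real.exp_add, pow_succ]
          congr 2
          ring

lemma sum_sq_eq {r : ℕ} (a : Fin r → ℝ) (x : ℝ) :
    ∑ σ : Fin r → Bool, (x + ∑ j, boolSign (σ j) * a j) ^ 2 =
      2 ^ r * (x ^ 2 + ∑ j, a j ^ 2) := by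
  induction r generalizing x with
  | zero => simp
  | succ r ih =>
    rw [sum_fin_succ_bool]
    simp only [Fin.sum_univ_succ, Fin.cons_zero, Fin.cons_succ, ← add_assoc,
      ih (fun j => a j.succ)]
    rw [Fintype.sum_bool]
    simp only [boolSign, if_true, Bool.false_eq_true, if_false]
    ring

lemma exp_le_one_add_add_sq_mul_exp_abs (y : ℝ) :
    Real.exp y ≤ 1 + y + y ^ 2 * Real.exp |y| := by
  have h := Complex.norm_exp_sub_sum_le_norm_mul_exp y 2
  have h1 : Complex.exp y - ∑ m ∈ range 2, (y : ℂ) ^ m / m.factorial =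
      ((Real.exp y - (1 + y) : ℝ) : ℂ) := by
    simp [sum_range_succ]
  rw [h1, Complex.norm_real, Complex.norm_real, Real.norm_eq_abs, Real.norm_eq_abs, sq_abs] at h
  linarith [(le_abs_self _).trans h]

/-- Moment generating function of the centred square of a normalized Rademacher sum. -/
lemma sum_exp_centered_sq_le {r : ℕ} (a : Fin r → ℝ) (ha : ∑ j, a j ^ 2 = 1) {l : ℝ}
    (hl : |l| ≤ 1 / 16) :
    ∑ σ : Fin r → Bool, Real.exp (l * ((∑ j, boolSign (σ j) * a j) ^ 2 - 1)) ≤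
      2 ^ r * Real.exp (1024 * l ^ 2) := by
  have hpt : ∀ X : ℝ, 0 ≤ X → Real.exp (l * (X - 1)) ≤
      1 + l * (X - 1) + 512 * l ^ 2 * (Real.exp (1 / 8) * Real.exp (1 / 8 * X)) := by
    intro X hX
    refine (exp_le_one_add_add_sq_mul_exp_abs _).trans ?_
    have h1 : |X - 1| ≤ X + 1 := abs_le.2 ⟨by linarith, by linarith⟩
    have h2 : |l * (X - 1)| ≤ (X + 1) / 16 := by
      rw [abs_mul]
      calc |l| * |X - 1| ≤ 1 / 16 * (X + 1) := mul_le_mul hl h1 (abs_nonneg _) (by norm_num)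
        _ = _ := by ring
    have h3 : (l * (X - 1)) ^ 2 ≤ l ^ 2 * (X + 1) ^ 2 := by
      rw [mul_pow]
      exact mul_le_mul_of_nonneg_left (by nlinarith) (sq_nonneg l)
    -- From `y ^ 2 / 2 ≤ exp y` at `y = (X + 1) / 16`; `512 = 2 * 16 ^ 2`.
    have h4 : (X + 1) ^ 2 ≤ 512 * Real.exp ((X + 1) / 16) := by
      have := Real.quadratic_le_exp_of_nonneg (x := (X + 1) / 16) (by positivity)
      nlinarith
    have h5 : (l * (X - 1)) ^ 2 * Real.exp |l * (X - 1)| ≤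
        (l ^ 2 * (512 * Real.exp ((X + 1) / 16))) * Real.exp ((X + 1) / 16) :=
      mul_le_mul (h3.trans (mul_le_mul_of_nonneg_left h4 (sq_nonneg l)))
        (Real.exp_le_exp.2 h2) (Real.exp_pos _).le (by positivity)
    have h6 : Real.exp ((X + 1) / 16) * Real.exp ((X + 1) / 16) =
        Real.exp (1 / 8) * Real.exp (1 / 8 * X) := by
      rw [← Real.exp_add, ← Real.exp_add]
      congr 1
      ring
    rw [← h6]
    linarith
  have hexp : ∑ σ : Fin r → Bool, Real.exp (1 / 8 * (∑ j, boolSign (σ j) * a j) ^ 2) ≤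
      2 ^ r * Real.exp (1 / 4) := by
    -- With unit variance, `1/8` is the largest admissible exponent: `1/8 + 1/8 = 1/4`.
    have := sum_exp_sq_le a (μ := 1 / 8) (by norm_num) (by rw [ha]; norm_num) 0
    simpa [ha] using this
  have hsq : ∑ σ : Fin r → Bool, (∑ j, boolSign (σ j) * a j) ^ 2 = 2 ^ r := by
    have := sum_sq_eq a 0
    simpa [ha] using this
  have hc : ∑ _σ : Fin r → Bool, (1 : ℝ) = 2 ^ r := by simp
  have he : Real.exp (1 / 8) * Real.exp (1 / 4) ≤ 2 := by
    rw [← Real.exp_add]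
    have h1 : (Real.exp (1 / 8 + 1 / 4)) ^ 2 ≤ 2 ^ 2 := by
      rw [← Real.exp_nat_mul]
      have : Real.exp ((2 : ℕ) * (1 / 8 + 1 / 4)) ≤ Real.exp 1 :=
        Real.exp_le_exp.2 (by norm_num)
      linarith [Real.exp_one_lt_d9]
    exact le_of_sq_le_sq h1 (by norm_num)
  calc _ ≤ ∑ σ : Fin r → Bool, (1 + l * ((∑ j, boolSign (σ j) * a j) ^ 2 - 1) +
        512 * l ^ 2 * (Real.exp (1 / 8) *
          Real.exp (1 / 8 * (∑ j, boolSign (σ j) * a j) ^ 2))) :=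
        sum_le_sum fun σ _ => hpt _ (sq_nonneg _)
    _ = 2 ^ r + 512 * l ^ 2 * (Real.exp (1 / 8) *
          ∑ σ : Fin r → Bool, Real.exp (1 / 8 * (∑ j, boolSign (σ j) * a j) ^ 2)) := by
        -- The term linear in `l` cancels because the square has mean one, so only the second-order
        -- term survives.
        rw [sum_add_distrib, sum_add_distrib, ← mul_sum, sum_sub_distrib, hsq, hc, ← mul_sum,
          ← mul_sum]
        ring
    _ ≤ 2 ^ r + 512 * l ^ 2 * (Real.exp (1 / 8) * (2 ^ r * Real.exp (1 / 4))) := by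
        gcongr
    _ = 2 ^ r * (1 + 512 * l ^ 2 * (Real.exp (1 / 8) * Real.exp (1 / 4))) := by ring
    _ ≤ 2 ^ r * (1 + 512 * l ^ 2 * 2) := by gcongr
    _ ≤ 2 ^ r * Real.exp (1024 * l ^ 2) := by
        refine mul_le_mul_of_nonneg_left ?_ (by positivity)
        linarith [Real.add_one_le_exp (1024 * l ^ 2)]

/-- Independence of the `n` samples: the sum over all patterns factors as an `n`-th power. -/
lemma sum_exp_sample_le {r : ℕ} (n : ℕ) (a : Fin r → ℝ) (ha : ∑ j, a j ^ 2 = 1) {l : ℝ}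
    (hl : |l| ≤ 1 / 16) :
    ∑ ω : Fin n → Fin r → Bool,
        Real.exp (l * ∑ i, ((∑ j, boolSign (ω i j) * a j) ^ 2 - 1)) ≤
      (2 ^ r) ^ n * Real.exp (n * (1024 * l ^ 2)) := by
  calc _ = (∑ σ : Fin r → Bool, Real.exp (l * ((∑ j, boolSign (σ j) * a j) ^ 2 - 1))) ^ n := by
        rw [Fintype.sum_pow]
        exact sum_congr rfl fun ω _ => by rw [mul_sum, Real.exp_sum]
    _ ≤ (2 ^ r * Real.exp (1024 * l ^ 2)) ^ n :=
        pow_le_pow_left₀ (sum_nonneg fun _ _ => (Real.exp_pos _).le)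
          (sum_exp_centered_sq_le a ha hl) n
    _ = _ := by rw [mul_pow, ← Real.exp_nat_mul]

/-- Sign patterns whose empirical second moments are close to the norms of finitely many given
unit vectors. -/
lemma exists_signs_of_normalized {r n : ℕ} {κ : Type*} [Fintype κ] (a : κ → Fin r → ℝ)
    (ha : ∀ k, ∑ j, a k j ^ 2 = 1) {ε : ℝ} (hε₀ : 0 < ε) (hε₁ : ε ≤ 1)
    (hn : 2 * (Fintype.card κ : ℝ) < Real.exp (n * (ε ^ 2 / 4096))) :
    ∃ ω : Fin n → Fin r → Bool, ∀ k,
      |∑ i, ((∑ j, boolSign (ω i j) * a k j) ^ 2 - 1)| ≤ n * ε := by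
  set D : (Fin n → Fin r → Bool) → κ → ℝ :=
    fun ω k => ∑ i, ((∑ j, boolSign (ω i j) * a k j) ^ 2 - 1) with hD
  -- This minimizes `1024 * l ^ 2 - l * ε`, with minimum `-ε ^ 2 / 4096`.
  set l := ε / 2048 with hl
  have hl' : |l| ≤ 1 / 16 := by rw [abs_of_pos (by positivity)]; linarith
  have hl'' : |-l| ≤ 1 / 16 := by rwa [abs_neg]
  -- Exponential Markov inequality and union bound in one function: `F ω < 1` forces every two-sided
  -- deviation to be at most `n * ε`.
  let F : (Fin n → Fin r → Bool) → ℝ := fun ω =>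
    ∑ k, (Real.exp (l * D ω k) + Real.exp (-l * D ω k)) * Real.exp (-(l * (n * ε)))
  have hF : ∑ ω, F ω < ∑ _ω : Fin n → Fin r → Bool, (1 : ℝ) := by
    have hE := Real.exp_pos (n * (ε ^ 2 / 4096))
    calc ∑ ω, F ω = ∑ k, ((∑ ω, Real.exp (l * D ω k)) + ∑ ω, Real.exp (-l * D ω k)) *
          Real.exp (-(l * (n * ε))) := by
          simp only [F]
          rw [sum_comm]
          exact sum_congr rfl fun k _ => by rw [← sum_mul, sum_add_distrib]
      _ ≤ ∑ _k : κ, ((2 ^ r) ^ n * Real.exp (n * (1024 * l ^ 2)) +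
            (2 ^ r) ^ n * Real.exp (n * (1024 * l ^ 2))) * Real.exp (-(l * (n * ε))) := by
          refine sum_le_sum fun k _ => mul_le_mul_of_nonneg_right (add_le_add ?_ ?_)
            (Real.exp_pos _).le
          · exact sum_exp_sample_le n (a k) (ha k) hl'
          · have := sum_exp_sample_le n (a k) (ha k) hl''
            rwa [neg_sq] at this
      _ = (2 ^ r) ^ n * (2 * (Fintype.card κ : ℝ) *
            (Real.exp (n * (1024 * l ^ 2)) * Real.exp (-(l * (n * ε))))) := by
          rw [sum_const, card_univ, nsmul_eq_mul]
          ring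
      _ = (2 ^ r) ^ n * (2 * (Fintype.card κ : ℝ) * (Real.exp (n * (ε ^ 2 / 4096)))⁻¹) := by
          rw [← Real.exp_add, ← Real.exp_neg]
          congr 3
          rw [hl]
          ring
      _ < (2 ^ r) ^ n * 1 := by
          refine mul_lt_mul_of_pos_left ?_ (by positivity)
          rwa [← div_eq_mul_inv, div_lt_one hE]
      _ = _ := by simp
  obtain ⟨ω, -, hω⟩ := exists_lt_of_sum_lt hF
  refine ⟨ω, fun k => ?_⟩
  have hk : (Real.exp (l * D ω k) + Real.exp (-l * D ω k)) * Real.exp (-(l * (n * ε))) < 1 :=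
    (single_le_sum (f := fun k => (Real.exp (l * D ω k) + Real.exp (-l * D ω k)) *
      Real.exp (-(l * (n * ε)))) (fun _ _ => by positivity) (mem_univ k)).trans_lt hω
  rw [add_mul, ← Real.exp_add, ← Real.exp_add] at hk
  have h1 := Real.exp_lt_one_iff.1 ((lt_add_of_pos_right _ (Real.exp_pos _)).trans hk)
  have h2 := Real.exp_lt_one_iff.1 ((lt_add_of_pos_left _ (Real.exp_pos _)).trans hk)
  have hlp : 0 < l := by positivity
  exact abs_le.2 ⟨by nlinarith, by nlinarith⟩

/-- Homogeneous form of `exists_signs_of_normalized`: zero vectors, which cannot be normalized, have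
zero deviation and are set aside. -/
lemma exists_signs {r n : ℕ} {κ : Type*} [Fintype κ] (a : κ → Fin r → ℝ)
    {ε : ℝ} (hε₀ : 0 < ε) (hε₁ : ε ≤ 1)
    (hn : 2 * (Fintype.card κ : ℝ) < Real.exp (n * (ε ^ 2 / 4096))) :
    ∃ ω : Fin n → Fin r → Bool, ∀ k,
      |∑ i, (∑ j, boolSign (ω i j) * a k j) ^ 2 - n * ∑ j, a k j ^ 2| ≤
        n * ε * ∑ j, a k j ^ 2 := by
  classical
  have hq : ∀ k, 0 ≤ ∑ j, a k j ^ 2 := fun k => sum_nonneg fun j _ => sq_nonneg _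
  let κ' := {k // ∑ j, a k j ^ 2 ≠ 0}
  let b : κ' → Fin r → ℝ := fun k j => a k j / √(∑ j, a k j ^ 2)
  obtain ⟨ω, hω⟩ := exists_signs_of_normalized (n := n) b (fun k => by
    simp only [b, div_pow, Real.sq_sqrt (hq _), ← sum_div]
    exact div_self k.2) hε₀ hε₁ (lt_of_le_of_lt (by
      have := Fintype.card_subtype_le fun k => ∑ j, a k j ^ 2 ≠ 0
      have : (Fintype.card κ' : ℝ) ≤ Fintype.card κ := by exact_mod_cast this
      linarith) hn)
  refine ⟨ω, fun k => ?_⟩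
  by_cases hk : ∑ j, a k j ^ 2 = 0
  · have : ∀ j, a k j = 0 := fun j => by
      simpa using (sum_eq_zero_iff_of_nonneg fun j _ => sq_nonneg (a k j)).1 hk j (mem_univ j)
    simp [this]
  · have hpos : 0 < ∑ j, a k j ^ 2 := lt_of_le_of_ne (hq k) (Ne.symm hk)
    have h := mul_le_mul_of_nonneg_right (hω ⟨k, hk⟩) hpos.le
    refine le_trans (le_of_eq ?_) h
    rw [← abs_of_pos hpos, ← abs_mul, abs_of_pos hpos]
    congr 1
    simp only [b, mul_div_assoc', ← sum_div, div_pow, Real.sq_sqrt (hq _), sum_sub_distrib]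
    rw [sub_mul, div_mul_cancel₀ _ hk]
    simp

end RandomSigns

/-! ### Kraus forms and complete positivity. -/

section Kraus

open Finset InnerProductSpace ContinuousLinearMap

variable {A B : Type*}
  [NormedAddCommGroup A] [InnerProductSpace ℂ A] [CompleteSpace A]
  [NormedAddCommGroup B] [InnerProductSpace ℂ B] [CompleteSpace B]

/-- The linear map `X ↦ ∑ i, K i X (K i)†`. -/
noncomputable def krausMap {ι : Type*} [Fintype ι] (K : ι → (A →L[ℂ] B)) :
    (A →L[ℂ] A) →ₗ[ℂ] (B →L[ℂ] B) where
  toFun X := ∑ i, K i ∘L X ∘L adjoint (K i)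
  map_add' X Y := by simp [add_comp, comp_add, sum_add_distrib]
  map_smul' c X := by simp [smul_sum]

lemma krausMap_apply {ι : Type*} [Fintype ι] (K : ι → (A →L[ℂ] B)) (X : A →L[ℂ] A) :
    krausMap K X = ∑ i, K i ∘L X ∘L adjoint (K i) := rfl

lemma comp_rankOne_comp_adjoint (K : A →L[ℂ] B) (x y : A) :
    K ∘L rankOne ℂ x y ∘L adjoint K = rankOne ℂ (K x) (K y) := by
  rw [rankOne_comp, comp_rankOne, adjoint_adjoint]

lemma krausMap_rankOne {ι : Type*} [Fintype ι] (K : ι → (A →L[ℂ] B)) (x y : A) :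
    krausMap K (rankOne ℂ x y) = ∑ i, rankOne ℂ (K i x) (K i y) := by
  simp only [krausMap_apply, comp_rankOne_comp_adjoint]

lemma hasKrausForm_krausMap {s : ℕ} (K : Fin s → (A →L[ℂ] B)) :
    HasKrausForm (krausMap K) s := ⟨K, fun _ => rfl⟩

lemma krausRank_krausMap_le {s : ℕ} (K : Fin s → (A →L[ℂ] B)) : krausRank (krausMap K) ≤ s :=
  Nat.sInf_le (hasKrausForm_krausMap K)

omit [CompleteSpace A] in
/-- A map of operator spaces is determined by its values on the matrix units of a basis. -/
lemma linearMap_ext_rankOne {V ι : Type*} [AddCommGroup V] [Module ℂ V] [Fintype ι]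
    (b : OrthonormalBasis ι ℂ A) {Φ Ψ : (A →L[ℂ] A) →ₗ[ℂ] V}
    (h : ∀ i j, Φ (rankOne ℂ (b i) (b j)) = Ψ (rankOne ℂ (b i) (b j))) : Φ = Ψ := by
  refine LinearMap.ext fun X => ?_
  have hX : X = ∑ j, ∑ i, inner ℂ (b i) (X (b j)) • rankOne ℂ (b i) (b j) := by
    have h1 : X = ∑ j, rankOne ℂ (X (b j)) (b j) := by
      simp_rw [← comp_rankOne, ← comp_finsetSum]
      rw [b.sum_rankOne_eq_id, comp_id]
    have h2 : ∀ j, rankOne ℂ (X (b j)) (b j) =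
        ∑ i, inner ℂ (b i) (X (b j)) • rankOne ℂ (b i) (b j) := fun j => by
      ext z
      simp only [rankOne_apply, _root_.sum_apply, _root_.smul_apply]
      conv_lhs => rw [← b.sum_repr' (X (b j)), smul_sum]
      exact sum_congr rfl fun i _ => smul_comm _ _ _
    conv_lhs => rw [h1]
    exact sum_congr rfl fun j _ => h2 j
  rw [hX]
  simp only [map_sum, map_smul, h]

lemma exists_eq_star_mul_self_of_nonneg {C : Type*} [CStarAlgebra C] [PartialOrder C]
    [StarOrderedRing C] {x : C} (h : 0 ≤ x) : ∃ y, x = star y * y :=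
  CStarAlgebra.nonneg_iff_eq_star_mul_self.1 h

/-- The block matrix `E` of matrix units is self-adjoint with `E * E = d • E`, hence equals `star P
* P` for `P = d^(-1/2) E`. -/
lemma matrixUnits_nonneg {d : ℕ} (b : OrthonormalBasis (Fin d) ℂ A) :
    0 ≤ CStarMatrix.ofMatrix (Matrix.of fun i j : Fin d => rankOne ℂ (b i) (b j)) := by
  set P : CStarMatrix (Fin d) (Fin d) (A →L[ℂ] A) :=
    CStarMatrix.ofMatrix (Matrix.of fun i j => ((√d)⁻¹ : ℂ) • rankOne ℂ (b i) (b j)) with hP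
  have : CStarMatrix.ofMatrix (Matrix.of fun i j : Fin d => rankOne ℂ (b i) (b j)) =
      star P * P := by
    ext1 i j
    have hd : (d : ℂ) ≠ 0 := by
      have := i.pos
      exact_mod_cast this.ne'
    have hs : ((√d : ℝ) : ℂ) * (√d : ℝ) = d := by
      rw [← Complex.ofReal_mul, Real.mul_self_sqrt (Nat.cast_nonneg d), Complex.ofReal_natCast]
    rw [CStarMatrix.mul_apply]
    have h1 : ∀ k, (star P) i k * P k j = (d : ℂ)⁻¹ • rankOne ℂ (b i) (b j) := fun k => by
      rw [CStarMatrix.star_apply]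
      simp only [hP, CStarMatrix.ofMatrix_apply, Matrix.of_apply, star_smul, star_eq_adjoint,
        adjoint_rankOne, ContinuousLinearMap.mul_def, smul_comp, comp_smul, rankOne_comp_rankOne, smul_smul]
      simp only [star_inv₀, RCLike.star_def, Complex.conj_ofReal, orthonormal_iff_ite.1 b.orthonormal,
        if_true, mul_one, ← mul_inv, hs]
    rw [sum_congr rfl fun k _ => h1 k]
    simp [← Nat.cast_smul_eq_nsmul ℂ, smul_smul, hd]
  rw [this]
  exact star_mul_self_nonneg P

/-- **Choi's theorem**: completely positive maps between operators on finite-dimensional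
spaces have a Kraus form. -/
theorem exists_eq_krausMap [FiniteDimensional ℂ A] [FiniteDimensional ℂ B]
    (N : CompletelyPositiveMap (A →L[ℂ] A) (B →L[ℂ] B)) :
    ∃ (s : ℕ) (K : Fin s → (A →L[ℂ] B)), N.toLinearMap = krausMap K := by
  let b := stdOrthonormalBasis ℂ A
  let c := stdOrthonormalBasis ℂ B
  have h := N.map_cstarMatrix_nonneg' _ _ (matrixUnits_nonneg b)
  obtain ⟨S, hS⟩ := exists_eq_star_mul_self_of_nonneg h
  have hent : ∀ i j, N.toLinearMap (rankOne ℂ (b i) (b j)) =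
      ∑ k, adjoint (S k i) ∘L S k j := fun i j => by
    have := congrArg (fun M => M i j) hS
    simpa [CStarMatrix.mul_apply, CStarMatrix.star_apply, star_eq_adjoint, ContinuousLinearMap.mul_def] using this
  -- The Choi matrix factors as `star S * S`. Inserting `∑ β, |c β⟩⟨c β|` between the two factors
  -- splits it into rank-one pieces, so `K (k, β)` must send `b i` to `(S k i)† (c β)`.
  let K : Fin (Module.finrank ℂ A) × Fin (Module.finrank ℂ B) → (A →L[ℂ] B) := fun p =>
    ∑ i, rankOne ℂ (adjoint (S p.1 i) (c p.2)) (b i)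
  have hK : ∀ p i, K p (b i) = adjoint (S p.1 i) (c p.2) := fun p i => by
    simp [K, orthonormal_iff_ite.1 b.orthonormal]
  let e := Fintype.equivFin (Fin (Module.finrank ℂ A) × Fin (Module.finrank ℂ B))
  refine ⟨_, fun l => K (e.symm l), linearMap_ext_rankOne b fun i j => ?_⟩
  rw [krausMap_rankOne, e.symm.sum_comp fun p => rankOne ℂ (K p (b i)) (K p (b j)), hent,
    Fintype.sum_prod_type]
  refine sum_congr rfl fun k _ => ?_
  simp only [hK]
  have : ∀ β, rankOne ℂ (adjoint (S k i) (c β)) (adjoint (S k j) (c β)) =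
      adjoint (S k i) ∘L rankOne ℂ (c β) (c β) ∘L S k j := fun β => by
    rw [rankOne_comp, comp_rankOne]
  simp only [this, ← comp_finsetSum, ← finsetSum_comp]
  rw [c.sum_rankOne_eq_id, id_comp]

/-- The factors `W l i` land in `A`, whereas positivity is wanted in matrices over operators on `B`.
Inserting a resolution of the identity of `A` and sending each basis vector to one fixed unit vector
`e` of `B` gives genuine factors `R p`, supported on row `0`. -/
lemma nonneg_of_eq_sum_adjoint_comp [FiniteDimensional ℂ A] {m k : ℕ}
    (W : Fin m → Fin k → (B →L[ℂ] A))
    (M : CStarMatrix (Fin k) (Fin k) (B →L[ℂ] B))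
    (hM : ∀ i j, M i j = ∑ l, adjoint (W l i) ∘L W l j) : 0 ≤ M := by
  rcases subsingleton_or_nontrivial B with hB | hB
  · have : M = 0 := by
      ext1 i j
      exact Subsingleton.elim _ _
    exact this.ge
  obtain ⟨e, he⟩ := exists_norm_eq B zero_le_one
  let b := stdOrthonormalBasis ℂ A
  let R : Fin m × Fin (Module.finrank ℂ A) → CStarMatrix (Fin k) (Fin k) (B →L[ℂ] B) :=
    fun p => CStarMatrix.ofMatrix (Matrix.of fun q j =>
      if (q : ℕ) = 0 then rankOne ℂ e (b p.2) ∘L W p.1 j else 0)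
  have : M = ∑ p, star (R p) * R p := by
    ext1 i j
    have hsum : (∑ p, star (R p) * R p) i j = ∑ p, (star (R p) * R p) i j := by
      change (∑ p, star (R p) * R p : Matrix _ _ _) i j = _
      exact Matrix.sum_apply i j univ _
    have hk : ∀ p, (star (R p) * R p) i j =
        adjoint (W p.1 i) ∘L rankOne ℂ (b p.2) (b p.2) ∘L W p.1 j := fun p => by
      rw [CStarMatrix.mul_apply, sum_eq_single (⟨0, i.pos⟩ : Fin k)]
      · simp only [CStarMatrix.star_apply, R, CStarMatrix.ofMatrix_apply, Matrix.of_apply,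
          if_true, star_eq_adjoint, ContinuousLinearMap.mul_def, adjoint_comp, adjoint_rankOne]
        rw [comp_assoc, ← comp_assoc (rankOne ℂ (b p.2) e), rankOne_comp_rankOne,
          inner_self_eq_norm_sq_to_K, he]
        simp
      · intro q _ hq
        have : (q : ℕ) ≠ 0 := fun h => hq (Fin.ext h)
        simp [CStarMatrix.star_apply, R, this]
      · simp
    rw [hsum, hM, Fintype.sum_prod_type]
    refine sum_congr rfl fun l _ => ?_
    simp only [hk, ← comp_finsetSum, ← finsetSum_comp]
    rw [b.sum_rankOne_eq_id, id_comp]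
  rw [this]
  exact sum_nonneg fun p _ => star_mul_self_nonneg (R p)

/-- A map given by a Kraus form is completely positive. -/
noncomputable def krausCPMap [FiniteDimensional ℂ A] {s : ℕ} (K : Fin s → (A →L[ℂ] B)) :
    CompletelyPositiveMap (A →L[ℂ] A) (B →L[ℂ] B) where
  toLinearMap := krausMap K
  map_cstarMatrix_nonneg' k M hM := by
    obtain ⟨R, rfl⟩ := exists_eq_star_mul_self_of_nonneg hM
    let e := finProdFinEquiv (m := s) (n := k)
    refine nonneg_of_eq_sum_adjoint_comp
      (fun l i => R (e.symm l).2 i ∘L adjoint (K (e.symm l).1)) _ fun i j => ?_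
    rw [e.symm.sum_comp fun p : Fin s × Fin k =>
      adjoint (R p.2 i ∘L adjoint (K p.1)) ∘L (R p.2 j ∘L adjoint (K p.1)), Fintype.sum_prod_type]
    rw [CStarMatrix.map_apply, CStarMatrix.mul_apply, krausMap_apply]
    refine sum_congr rfl fun l _ => ?_
    simp only [finsetSum_comp, comp_finsetSum, CStarMatrix.star_apply, star_eq_adjoint, ContinuousLinearMap.mul_def,
      adjoint_comp, adjoint_adjoint, comp_assoc]

end Kraus

/-! ### Nets of balls, and operator norms computed on them. -/

section Nets

open Finset

/-- A 1-separated set in the ball that fails to cover it can be enlarged; the Besicovitch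
cardinality bound stops this growth. -/
lemma exists_finset_cover_closedBall_two (E : Type*) [NormedAddCommGroup E] [NormedSpace ℝ E]
    [FiniteDimensional ℝ E] :
    ∃ s : Finset E, s.card ≤ 5 ^ Module.finrank ℝ E ∧ (∀ c ∈ s, ‖c‖ ≤ 2) ∧
      ∀ x : E, ‖x‖ ≤ 2 → ∃ c ∈ s, ‖x - c‖ < 1 := by
  classical
  by_contra! h
  have key : ∀ k : ℕ, ∃ s : Finset E, s.card = k ∧ (∀ c ∈ s, ‖c‖ ≤ 2) ∧
      ∀ c ∈ s, ∀ d ∈ s, c ≠ d → 1 ≤ ‖c - d‖ := by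
    intro k
    induction k with
    | zero => exact ⟨∅, by simp⟩
    | succ k ih =>
      obtain ⟨s, hk, hs, hsep⟩ := ih
      obtain ⟨x, hx, hxs⟩ := h s (Besicovitch.card_le_of_separated s hs hsep) hs
      have hxn : x ∉ s := fun hmem => by
        have := hxs x hmem
        simp at this
        linarith
      refine ⟨insert x s, by rw [card_insert_of_notMem hxn, hk], ?_, ?_⟩
      · intro c hc
        rcases mem_insert.1 hc with rfl | hc
        exacts [hx, hs c hc]
      · intro c hc d hd hcd
        rcases mem_insert.1 hc with rfl | hc' <;> rcases mem_insert.1 hd with rfl | hd'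
        · exact absurd rfl hcd
        · exact hxs d hd'
        · rw [norm_sub_rev]
          exact hxs c hc'
        · exact hsep c hc' d hd' hcd
  obtain ⟨s, hk, hs, hsep⟩ := key (5 ^ Module.finrank ℝ E + 1)
  have := Besicovitch.card_le_of_separated s hs hsep
  omega

/-- A quarter net of the unit ball, of cardinality exponential in the dimension. -/
lemma exists_quarter_net (E : Type*) [NormedAddCommGroup E] [InnerProductSpace ℂ E]
    [FiniteDimensional ℂ E] :
    ∃ t : Finset E, t.card ≤ 625 ^ Module.finrank ℂ E ∧ (∀ c ∈ t, ‖c‖ ≤ 3 / 2) ∧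
      ∀ x : E, ‖x‖ ≤ 1 → ∃ c ∈ t, ‖x - c‖ ≤ 1 / 4 := by
  classical
  obtain ⟨s, hcard, hs, hcov⟩ := exists_finset_cover_closedBall_two E
  -- Two-scale approximation: `c` is within 1 of `2x`, then `d` is within 1 of `2(2x - c)`, so `(2c
  -- + d) / 4` is within `1/4` of `x`. Real dimension being twice the complex one, the count is `25
  -- ^ (2d) = 625 ^ d`.
  refine ⟨(s ×ˢ s).image fun p => (1 / 4 : ℝ) • ((2 : ℝ) • p.1 + p.2), ?_, ?_, ?_⟩
  · refine card_image_le.trans ?_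
    rw [card_product]
    refine (Nat.mul_le_mul hcard hcard).trans (le_of_eq ?_)
    rw [finrank_real_of_complex, ← mul_pow, pow_mul]
    norm_num
  · intro c hc
    obtain ⟨p, hp, rfl⟩ := mem_image.1 hc
    obtain ⟨h1, h2⟩ := mem_product.1 hp
    rw [norm_smul]
    have h3 := norm_add_le ((2 : ℝ) • p.1) p.2
    rw [norm_smul] at h3
    have h4 := hs _ h1
    have h5 := hs _ h2
    norm_num at h3 ⊢
    linarith
  · intro x hx
    obtain ⟨c, hc, hxc⟩ := hcov ((2 : ℝ) • x) (by rw [norm_smul]; norm_num; linarith)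
    obtain ⟨d, hd, hxd⟩ := hcov ((2 : ℝ) • ((2 : ℝ) • x - c)) (by
      rw [norm_smul]; norm_num; linarith)
    refine ⟨_, mem_image_of_mem _ (mem_product.2 (⟨hc, hd⟩ : (c, d).1 ∈ s ∧ (c, d).2 ∈ s)), ?_⟩
    have : x - (1 / 4 : ℝ) • ((2 : ℝ) • c + d) =
        (1 / 4 : ℝ) • ((2 : ℝ) • ((2 : ℝ) • x - c) - d) := by module
    rw [this, norm_smul]
    norm_num
    linarith

/-- The norm of a self-adjoint operator is the supremum of its absolute quadratic form on unit
vectors. Moving a unit vector to the net costs at most `(1/4 + 1/4 * 3/2) ‖T‖ = 5/8 ‖T‖`, which is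
absorbed on the left: `‖T‖ ≤ 8/3 * m`. -/
lemma norm_le_of_net {E : Type*} [NormedAddCommGroup E] [InnerProductSpace ℂ E]
    [CompleteSpace E] {T : E →L[ℂ] E} (hT : IsSelfAdjoint T) {t : Finset E}
    (ht : ∀ c ∈ t, ‖c‖ ≤ 3 / 2) (hcov : ∀ x : E, ‖x‖ ≤ 1 → ∃ c ∈ t, ‖x - c‖ ≤ 1 / 4)
    {m : ℝ} (hm : 0 ≤ m) (h : ∀ c ∈ t, |T.reApplyInnerSelf c| ≤ m) : ‖T‖ ≤ 3 * m := by
  have hunit : ∀ x : E, ‖x‖ = 1 → |T.reApplyInnerSelf x| ≤ m + 5 / 8 * ‖T‖ := by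
    intro x hx
    obtain ⟨c, hc, hxc⟩ := hcov x hx.le
    have hsplit : T.reApplyInnerSelf x = T.reApplyInnerSelf c +
        (RCLike.re (inner ℂ (T x) (x - c)) + RCLike.re (inner ℂ (T (x - c)) c)) := by
      simp only [ContinuousLinearMap.reApplyInnerSelf, map_sub, inner_sub_left, inner_sub_right]
      ring
    have h1 : |RCLike.re (inner ℂ (T x) (x - c))| ≤ 1 / 4 * ‖T‖ := by
      refine (RCLike.abs_re_le_norm _).trans ((norm_inner_le_norm _ _).trans ?_)
      have := T.le_opNorm x
      rw [hx, mul_one] at this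
      nlinarith [norm_nonneg (T x), norm_nonneg (x - c), norm_nonneg T]
    have h2 : |RCLike.re (inner ℂ (T (x - c)) c)| ≤ 3 / 8 * ‖T‖ := by
      refine (RCLike.abs_re_le_norm _).trans ((norm_inner_le_norm _ _).trans ?_)
      have h3 := T.le_opNorm (x - c)
      have h4 : ‖T (x - c)‖ ≤ 1 / 4 * ‖T‖ :=
        h3.trans (by nlinarith [norm_nonneg T])
      calc ‖T (x - c)‖ * ‖c‖ ≤ (1 / 4 * ‖T‖) * (3 / 2) :=
            mul_le_mul h4 (ht c hc) (norm_nonneg c) (by positivity)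
        _ = _ := by ring
    rw [hsplit]
    have h3 := abs_add_le (T.reApplyInnerSelf c)
      (RCLike.re (inner ℂ (T x) (x - c)) + RCLike.re (inner ℂ (T (x - c)) c))
    have h4 := abs_add_le (RCLike.re (inner ℂ (T x) (x - c))) (RCLike.re (inner ℂ (T (x - c)) c))
    linarith [h c hc]
  have hsup : ‖T‖ ≤ m + 5 / 8 * ‖T‖ := by
    conv_lhs => rw [T.norm_eq_iSup_rayleighQuotient hT.isSymmetric]
    refine ciSup_le fun x => ?_
    rcases eq_or_ne x 0 with rfl | hx
    · rw [T.rayleighQuotient_apply_zero, abs_zero]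
      positivity
    · have hx' : ‖((‖x‖⁻¹ : ℝ) : ℂ) • x‖ = 1 := by
        rw [norm_smul, Complex.norm_real, norm_inv, norm_norm,
          inv_mul_cancel₀ (norm_ne_zero_iff.2 hx)]
      have hc : ((‖x‖⁻¹ : ℝ) : ℂ) ≠ 0 := by
        exact_mod_cast inv_ne_zero (norm_ne_zero_iff.2 hx)
      rw [← T.rayleigh_smul x hc, ContinuousLinearMap.rayleighQuotient, hx', one_pow, div_one]
      exact hunit _ hx'
  linarith

end Nets

/-! ### From deviations on nets to the supremum over density operators. -/

section Deviation

open Finset InnerProductSpace ContinuousLinearMap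

lemma isSelfAdjoint_sum_rankOne {E ι : Type*} [NormedAddCommGroup E] [InnerProductSpace ℂ E]
    [CompleteSpace E] [Fintype ι] (v : ι → E) :
    IsSelfAdjoint (∑ i, rankOne ℂ (v i) (v i)) := by
  rw [isSelfAdjoint_iff', map_sum]
  simp

lemma reApplyInnerSelf_sum_rankOne {E ι : Type*} [NormedAddCommGroup E] [InnerProductSpace ℂ E]
    [Fintype ι] (v : ι → E) (z : E) :
    (∑ i, rankOne ℂ (v i) (v i)).reApplyInnerSelf z = ∑ i, ‖inner ℂ (v i) z‖ ^ 2 := by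
  rw [reApplyInnerSelf, _root_.sum_apply, sum_inner, map_sum]
  refine sum_congr rfl fun i _ => ?_
  rw [inner_left_rankOne_apply, ← inner_conj_symm z (v i), RCLike.conj_mul]
  norm_cast

lemma reApplyInnerSelf_sub_apply {E : Type*} [NormedAddCommGroup E] [InnerProductSpace ℂ E]
    (S T : E →L[ℂ] E) (z : E) :
    (S - T).reApplyInnerSelf z = S.reApplyInnerSelf z - T.reApplyInnerSelf z := by
  simp [reApplyInnerSelf, inner_sub_left]

lemma abs_reApplyInnerSelf_le {E : Type*} [NormedAddCommGroup E] [InnerProductSpace ℂ E]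
    (T : E →L[ℂ] E) (z : E) : |T.reApplyInnerSelf z| ≤ ‖T‖ * ‖z‖ ^ 2 := by
  refine (RCLike.abs_re_le_norm _).trans ((norm_inner_le_norm _ _).trans ?_)
  rw [sq, ← mul_assoc]
  exact mul_le_mul_of_nonneg_right (T.le_opNorm z) (norm_nonneg z)

variable {A B : Type*}
  [NormedAddCommGroup A] [InnerProductSpace ℂ A] [CompleteSpace A]
  [NormedAddCommGroup B] [InnerProductSpace ℂ B] [CompleteSpace B]

/-- The value `⟨y, Φ(|x⟩⟨x|) y⟩` for the map `Φ` with Kraus operators `K`. -/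
noncomputable def krausForm {ι : Type*} [Fintype ι] (K : ι → (A →L[ℂ] B)) (x : A) (y : B) : ℝ :=
  ∑ i, ‖inner ℂ y (K i x)‖ ^ 2

lemma reApplyInnerSelf_krausMap {ι : Type*} [Fintype ι] (K : ι → (A →L[ℂ] B)) (x : A) (y : B) :
    (krausMap K (rankOne ℂ x x)).reApplyInnerSelf y = krausForm K x y := by
  rw [krausMap_rankOne, reApplyInnerSelf_sum_rankOne, krausForm]
  simp only [norm_inner_symm y]

lemma reApplyInnerSelf_dual {ι : Type*} [Fintype ι] (K : ι → (A →L[ℂ] B)) (x : A) (y : B) :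
    (∑ i, rankOne ℂ (adjoint (K i) y) (adjoint (K i) y)).reApplyInnerSelf x =
      krausForm K x y := by
  rw [reApplyInnerSelf_sum_rankOne, krausForm]
  simp only [adjoint_inner_left]

lemma isSelfAdjoint_krausMap_rankOne {ι : Type*} [Fintype ι] (K : ι → (A →L[ℂ] B)) (x : A) :
    IsSelfAdjoint (krausMap K (rankOne ℂ x x)) := by
  rw [krausMap_rankOne]
  exact isSelfAdjoint_sum_rankOne fun i => K i x

/-- For fixed `y` the form is quadratic in `x`, given by a self-adjoint operator on `A`; for fixed
`x` it is quadratic in `y`, given by one on `B`. Each use of `norm_le_of_net` costs a factor 3. -/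
lemma norm_krausMap_sub_rankOne_le {ι κ : Type*} [Fintype ι] [Fintype κ]
    (K' : ι → (A →L[ℂ] B)) (K : κ → (A →L[ℂ] B)) {t : Finset A} {s : Finset B}
    (ht : ∀ c ∈ t, ‖c‖ ≤ 3 / 2) (htc : ∀ x : A, ‖x‖ ≤ 1 → ∃ c ∈ t, ‖x - c‖ ≤ 1 / 4)
    (hs : ∀ c ∈ s, ‖c‖ ≤ 3 / 2) (hsc : ∀ x : B, ‖x‖ ≤ 1 → ∃ c ∈ s, ‖x - c‖ ≤ 1 / 4)
    {m : ℝ} (hm : 0 ≤ m)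
    (h : ∀ x ∈ t, ∀ y ∈ s, |krausForm K' x y - krausForm K x y| ≤ m) (x : A) :
    ‖(krausMap K' - krausMap K) (rankOne ℂ x x)‖ ≤ 9 * m * ‖x‖ ^ 2 := by
  have hdual : ∀ y ∈ s, |krausForm K' x y - krausForm K x y| ≤ 3 * m * ‖x‖ ^ 2 := by
    intro y hy
    have hsa := (isSelfAdjoint_sum_rankOne fun i => adjoint (K' i) y).sub
      (isSelfAdjoint_sum_rankOne fun i => adjoint (K i) y)
    have hnorm := norm_le_of_net hsa ht htc hm fun c hc => by
      rw [reApplyInnerSelf_sub_apply, reApplyInnerSelf_dual, reApplyInnerSelf_dual]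
      exact h c hc y hy
    rw [← reApplyInnerSelf_dual, ← reApplyInnerSelf_dual K, ← reApplyInnerSelf_sub_apply]
    exact (abs_reApplyInnerSelf_le _ x).trans
      (mul_le_mul_of_nonneg_right hnorm (sq_nonneg _))
  have hsa := (isSelfAdjoint_krausMap_rankOne K' x).sub (isSelfAdjoint_krausMap_rankOne K x)
  have hnorm := norm_le_of_net hsa hs hsc (m := 3 * m * ‖x‖ ^ 2) (by positivity) fun y hy => by
    rw [reApplyInnerSelf_sub_apply, reApplyInnerSelf_krausMap, reApplyInnerSelf_krausMap]
    exact hdual y hy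
  rw [LinearMap.sub_apply]
  linarith

variable [FiniteDimensional ℂ A]

lemma supOpNorm_nonneg {A B : Type*} [NormedAddCommGroup A] [InnerProductSpace ℂ A]
    [NormedAddCommGroup B] [InnerProductSpace ℂ B]
    (Φ : (A →L[ℂ] A) →ₗ[ℂ] (B →L[ℂ] B)) : 0 ≤ supOpNorm Φ :=
  Real.iSup_nonneg fun _ => norm_nonneg _

-- A density operator is a sum of rank-one operators `|u i⟩⟨u i|` with `∑ ‖u i‖ ^ 2 = 1`, so the
-- triangle inequality suffices.
omit [CompleteSpace A] [CompleteSpace B] in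
lemma supOpNorm_le_of_rankOne {Φ : (A →L[ℂ] A) →ₗ[ℂ] (B →L[ℂ] B)} {m : ℝ} (hm : 0 ≤ m)
    (h : ∀ x, ‖Φ (rankOne ℂ x x)‖ ≤ m * ‖x‖ ^ 2) : supOpNorm Φ ≤ m := by
  refine Real.iSup_le (fun ρ => ?_) hm
  obtain ⟨ρ, hpos, htr⟩ := ρ
  obtain ⟨k, u, rfl⟩ := isPositive_iff_eq_sum_rankOne.1 hpos
  have hsum : ∑ i, ‖u i‖ ^ 2 = 1 := by
    rw [ContinuousLinearMap.toLinearMap_sum, map_sum] at htr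
    simp only [trace_rankOne, inner_self_eq_norm_sq_to_K] at htr
    refine Complex.ofReal_injective ?_
    push_cast
    exact htr
  calc ‖Φ (∑ i, rankOne ℂ (u i) (u i))‖ ≤ ∑ i, ‖Φ (rankOne ℂ (u i) (u i))‖ := by
        rw [map_sum]
        exact norm_sum_le _ _
    _ ≤ ∑ i, m * ‖u i‖ ^ 2 := sum_le_sum fun i _ => h (u i)
    _ = m := by rw [← mul_sum, hsum, mul_one]

lemma rankOne_self_mem_densityOperators {A : Type*} [NormedAddCommGroup A] [InnerProductSpace ℂ A]
    [FiniteDimensional ℂ A] {x : A} (hx : ‖x‖ = 1) : rankOne ℂ x x ∈ densityOperators A := by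
  refine ⟨isPositive_rankOne_self x, ?_⟩
  rw [trace_rankOne, inner_self_eq_norm_sq_to_K, hx]
  simp

omit [CompleteSpace B] in
lemma norm_apply_rankOne_le (Φ : (A →L[ℂ] A) →ₗ[ℂ] (B →L[ℂ] B)) (x : A) :
    ‖Φ (rankOne ℂ x x)‖ ≤ supOpNorm Φ * ‖x‖ ^ 2 := by
  rcases eq_or_ne x 0 with rfl | hx
  · simp
  have hx0 : ‖x‖ ≠ 0 := norm_ne_zero_iff.2 hx
  set z : A := ((‖x‖⁻¹ : ℝ) : ℂ) • x with hz
  have hz1 : ‖z‖ = 1 := by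
    rw [hz, norm_smul, Complex.norm_real, norm_inv, norm_norm, inv_mul_cancel₀ hx0]
  have hxz : x = ((‖x‖ : ℝ) : ℂ) • z := by
    rw [hz, smul_smul, ← Complex.ofReal_mul, mul_inv_cancel₀ hx0, Complex.ofReal_one, one_smul]
  have hr : rankOne ℂ x x = ((‖x‖ ^ 2 : ℝ) : ℂ) • rankOne ℂ z z := by
    conv_lhs => rw [hxz]
    ext w
    simp only [rankOne_apply, _root_.smul_apply, inner_smul_left, Complex.conj_ofReal, smul_smul]
    push_cast
    congr 1
    ring
  have hle := le_ciSup (bddAbove_supOpNorm Φ) ⟨_, rankOne_self_mem_densityOperators hz1⟩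
  rw [hr, map_smul, norm_smul, Complex.norm_real, Real.norm_of_nonneg (sq_nonneg _), mul_comm]
  exact mul_le_mul_of_nonneg_right hle (sq_nonneg _)

lemma krausForm_le {ι : Type*} [Fintype ι] (K : ι → (A →L[ℂ] B)) (x : A) (y : B) :
    krausForm K x y ≤ supOpNorm (krausMap K) * ‖x‖ ^ 2 * ‖y‖ ^ 2 := by
  rw [← reApplyInnerSelf_krausMap]
  exact (le_abs_self _).trans ((abs_reApplyInnerSelf_le _ y).trans
    (mul_le_mul_of_nonneg_right (norm_apply_rankOne_le _ x) (sq_nonneg _)))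

end Deviation

/-! ### Sampling Kraus operators and choosing the sample size. -/

section Sampling

open Finset

variable {A B : Type*}
  [NormedAddCommGroup A] [InnerProductSpace ℂ A]
  [NormedAddCommGroup B] [InnerProductSpace ℂ B]

/-- The Kraus operators obtained by combining the operators `K j` with `n` sign patterns. -/
noncomputable def signedKraus {n r : ℕ} (K : Fin r → (A →L[ℂ] B)) (ω : Fin n → Fin r → Bool)
    (i : Fin n) : A →L[ℂ] B :=
  (((√n)⁻¹ : ℝ) : ℂ) • ∑ j, (boolSign (ω i j) : ℂ) • K j

lemma inner_signedKraus {n r : ℕ} (K : Fin r → (A →L[ℂ] B)) (ω : Fin n → Fin r → Bool)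
    (i : Fin n) (x : A) (y : B) :
    ‖inner ℂ y (signedKraus K ω i x)‖ ^ 2 =
      (n : ℝ)⁻¹ * ((∑ j, boolSign (ω i j) * (inner ℂ y (K j x)).re) ^ 2 +
        (∑ j, boolSign (ω i j) * (inner ℂ y (K j x)).im) ^ 2) := by
  have h : inner ℂ y (signedKraus K ω i x) = (((√n)⁻¹ : ℝ) : ℂ) *
      ∑ j, (boolSign (ω i j) : ℂ) * inner ℂ y (K j x) := by
    simp [signedKraus]
  rw [h, norm_mul, mul_pow, Complex.norm_real, Real.norm_eq_abs, sq_abs, inv_pow,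
    Real.sq_sqrt (Nat.cast_nonneg n), ← Complex.normSq_eq_norm_sq, Complex.normSq_apply]
  simp only [Complex.re_sum, Complex.im_sum, Complex.re_ofReal_mul, Complex.im_ofReal_mul, sq]

lemma exists_signs_krausForm {n r : ℕ} (hn0 : 0 < n) (K : Fin r → (A →L[ℂ] B))
    (t : Finset A) (s : Finset B) {ε : ℝ} (hε₀ : 0 < ε) (hε₁ : ε ≤ 1)
    (hn : 4 * ((t.card : ℝ) * s.card) < Real.exp (n * (ε ^ 2 / 4096))) :
    ∃ ω : Fin n → Fin r → Bool, ∀ x ∈ t, ∀ y ∈ s,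
      |krausForm (signedKraus K ω) x y - krausForm K x y| ≤ ε * krausForm K x y := by
  -- Real and imaginary parts count as separate real vectors; this doubles the union bound, hence
  -- the `4` in `hn`.
  let a : (t × s) × Bool → Fin r → ℝ := fun p j =>
    if p.2 then (inner ℂ (p.1.2 : B) (K j (p.1.1 : A))).re
    else (inner ℂ (p.1.2 : B) (K j (p.1.1 : A))).im
  obtain ⟨ω, hω⟩ := exists_signs (n := n) a hε₀ hε₁ (by
    refine lt_of_le_of_lt (le_of_eq ?_) hn
    simp
    ring)
  refine ⟨ω, fun x hx y hy => ?_⟩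
  have h1 := hω ((⟨x, hx⟩, ⟨y, hy⟩), true)
  have h2 := hω ((⟨x, hx⟩, ⟨y, hy⟩), false)
  simp only [a, if_true, Bool.false_eq_true, if_false] at h1 h2
  set P := ∑ j, (inner ℂ y (K j x)).re ^ 2
  set Q := ∑ j, (inner ℂ y (K j x)).im ^ 2
  set P' := ∑ i, (∑ j, boolSign (ω i j) * (inner ℂ y (K j x)).re) ^ 2
  set Q' := ∑ i, (∑ j, boolSign (ω i j) * (inner ℂ y (K j x)).im) ^ 2
  have hK : krausForm K x y = P + Q := by
    rw [krausForm, ← sum_add_distrib]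
    refine sum_congr rfl fun j _ => ?_
    rw [← Complex.normSq_eq_norm_sq, Complex.normSq_apply, sq, sq]
  have hK' : krausForm (signedKraus K ω) x y = (n : ℝ)⁻¹ * (P' + Q') := by
    simp only [krausForm, inner_signedKraus]
    rw [← mul_sum, sum_add_distrib]
  have hnpos : (0 : ℝ) < n := by exact_mod_cast hn0
  have heq : (n : ℝ)⁻¹ * (P' + Q') - (P + Q) =
      (n : ℝ)⁻¹ * ((P' - n * P) + (Q' - n * Q)) := by
    field_simp
    ring
  rw [hK, hK', heq, abs_mul, abs_of_pos (inv_pos.2 hnpos), inv_mul_le_iff₀ hnpos]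
  refine (abs_add_le _ _).trans ((add_le_add h1 h2).trans (le_of_eq ?_))
  ring

variable [CompleteSpace A] [CompleteSpace B]

/-- Sparsification of a Kraus form at a sufficiently large sample size. -/
theorem exists_signs_supOpNorm_le [FiniteDimensional ℂ A] [FiniteDimensional ℂ B]
    {n r : ℕ} (K : Fin r → (A →L[ℂ] B)) {ε D : ℝ} (hε₀ : 0 < ε) (hε₁ : ε ≤ 1) (hD : 1 ≤ D)
    (hA : (Module.finrank ℂ A : ℝ) ≤ D) (hB : (Module.finrank ℂ B : ℝ) ≤ D)
    (hn : 2 ^ 28 * D / ε ^ 2 ≤ n) :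
    ∃ ω : Fin n → Fin r → Bool,
      supOpNorm (krausMap (signedKraus K ω) - krausMap K) ≤ ε * supOpNorm (krausMap K) := by
  obtain ⟨t, htcard, ht, htc⟩ := exists_quarter_net A
  obtain ⟨s, hscard, hs, hsc⟩ := exists_quarter_net B
  have he7 : (625 : ℝ) ≤ Real.exp 7 := by
    have h1 : Real.exp 7 = Real.exp 1 ^ 7 := by rw [← Real.exp_nat_mul]; norm_num
    have h2 : (2.7 : ℝ) ^ 7 ≤ Real.exp 1 ^ 7 :=
      pow_le_pow_left₀ (by norm_num) (by linarith [Real.exp_one_gt_d9]) 7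
    rw [h1]
    norm_num at h2 ⊢
    linarith
  have hpow : ∀ d : ℕ, (d : ℝ) ≤ D → (625 : ℝ) ^ d ≤ Real.exp (7 * D) := by
    intro d hd
    calc (625 : ℝ) ^ d ≤ Real.exp 7 ^ d := pow_le_pow_left₀ (by norm_num) he7 d
      _ = Real.exp (d * 7) := by rw [Real.exp_nat_mul]
      _ ≤ Real.exp (7 * D) := Real.exp_le_exp.2 (by linarith)
  have ht' : (t.card : ℝ) ≤ Real.exp (7 * D) :=
    (by exact_mod_cast htcard : (t.card : ℝ) ≤ 625 ^ Module.finrank ℂ A).trans (hpow _ hA)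
  have hs' : (s.card : ℝ) ≤ Real.exp (7 * D) :=
    (by exact_mod_cast hscard : (s.card : ℝ) ≤ 625 ^ Module.finrank ℂ B).trans (hpow _ hB)
  have h4 : (4 : ℝ) < Real.exp (2 * D) := by
    have h1 : Real.exp 2 = Real.exp 1 ^ 2 := by rw [← Real.exp_nat_mul]; norm_num
    have h2 : Real.exp 2 ≤ Real.exp (2 * D) := Real.exp_le_exp.2 (by linarith)
    nlinarith [Real.exp_one_gt_d9]
  -- Accuracy `ε / 64` absorbs the net losses: `9 * (3/2) ^ 4 < 64`. Since `64 ^ 2 * 4096 = 2 ^ 24`,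
  -- the sample size `2 ^ 28 * D / ε ^ 2` makes the exponent at least `16 * D`.
  have hcount : 4 * ((t.card : ℝ) * s.card) < Real.exp (n * ((ε / 64) ^ 2 / 4096)) := by
    calc 4 * ((t.card : ℝ) * s.card) ≤ 4 * (Real.exp (7 * D) * Real.exp (7 * D)) := by gcongr
      _ < Real.exp (2 * D) * (Real.exp (7 * D) * Real.exp (7 * D)) :=
          mul_lt_mul_of_pos_right h4 (by positivity)
      _ = Real.exp (16 * D) := by
          rw [← Real.exp_add, ← Real.exp_add]
          congr 1
          ring
      _ ≤ _ := by
          refine Real.exp_le_exp.2 ?_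
          rw [div_le_iff₀ (by positivity)] at hn
          linarith
  have hn0 : 0 < n := by
    have : (0 : ℝ) < n := lt_of_lt_of_le (by positivity) hn
    exact_mod_cast this
  obtain ⟨ω, hω⟩ := exists_signs_krausForm hn0 K t s (ε := ε / 64) (by positivity) (by linarith)
    hcount
  refine ⟨ω, ?_⟩
  set M := supOpNorm (krausMap K) with hM
  have hM0 : 0 ≤ M := supOpNorm_nonneg _
  have hdev : ∀ x ∈ t, ∀ y ∈ s, |krausForm (signedKraus K ω) x y - krausForm K x y| ≤
      ε / 64 * (M * (3 / 2) ^ 2 * (3 / 2) ^ 2) := by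
    intro x hx y hy
    refine (hω x hx y hy).trans (mul_le_mul_of_nonneg_left ?_ (by positivity))
    refine (krausForm_le K x y).trans ?_
    have h1 := ht x hx
    have h2 := hs y hy
    gcongr
  refine (supOpNorm_le_of_rankOne (by positivity) (norm_krausMap_sub_rankOne_le _ K ht htc hs hsc
    (by positivity) hdev)).trans ?_
  nlinarith [mul_nonneg hε₀.le hM0]

lemma supOpNorm_zero_le {A B : Type*} [NormedAddCommGroup A] [InnerProductSpace ℂ A]
    [NormedAddCommGroup B] [InnerProductSpace ℂ B] :
    supOpNorm (0 : (A →L[ℂ] A) →ₗ[ℂ] (B →L[ℂ] B)) ≤ 0 :=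
  Real.iSup_le (fun _ => by simp) le_rfl

end Sampling

theorem theorem2 :
    ∃ C : ℝ, 0 < C ∧
      ∀ (A : Type u) [NormedAddCommGroup A] [InnerProductSpace ℂ A] [FiniteDimensional ℂ A]
        [CompleteSpace A]
        (B : Type v) [NormedAddCommGroup B] [InnerProductSpace ℂ B] [FiniteDimensional ℂ B]
        [CompleteSpace B]
        (ε : ℝ) (_hε₀ : 0 < ε) (_hε₁ : ε < 1)
        (N : CompletelyPositiveMap (A →L[ℂ] A) (B →L[ℂ] B))
        (_hN : IsTracePreserving N.toLinearMap)
        (_hA : Module.finrank ℂ A ≤ krausRank N.toLinearMap)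
        (_hB : Module.finrank ℂ B ≤ krausRank N.toLinearMap),
        ∃ N' : CompletelyPositiveMap (A →L[ℂ] A) (B →L[ℂ] B),
          (krausRank N'.toLinearMap : ℝ) ≤
              C * max (Module.finrank ℂ A : ℝ) (Module.finrank ℂ B : ℝ) / ε ^ 2 ∧
            supOpNorm (N'.toLinearMap - N.toLinearMap) ≤ ε * supOpNorm N.toLinearMap := by
  -- Twice `2 ^ 28`: rounding the sample size up to an integer at most doubles it, as it is at least
  -- 1.
  refine ⟨2 ^ 29, by norm_num, ?_⟩
  intro A _ _ _ _ B _ _ _ _ ε hε₀ hε₁ N _ _ _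
  obtain ⟨r, K, hK⟩ := exists_eq_krausMap N
  set D : ℝ := max (Module.finrank ℂ A : ℝ) (Module.finrank ℂ B : ℝ) with hD
  have hA : (Module.finrank ℂ A : ℝ) ≤ D := le_max_left _ _
  have hB : (Module.finrank ℂ B : ℝ) ≤ D := le_max_right _ _
  -- For trivial `A` the bound `1 ≤ D` may fail, but then the channel itself has Kraus rank 0 and
  -- serves as its own approximation.
  rcases Nat.eq_zero_or_pos (Module.finrank ℂ A) with hA0 | hA0
  · have : Subsingleton A := Module.finrank_zero_iff.1 hA0
    refine ⟨N, ?_, ?_⟩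
    · have h0 : krausRank N.toLinearMap = 0 := by
        refine Nat.eq_zero_of_le_zero (Nat.sInf_le ⟨Fin.elim0, fun X => ?_⟩)
        rw [Subsingleton.elim X 0, map_zero]
        simp
      rw [h0, Nat.cast_zero]
      have : 0 ≤ D := (Nat.cast_nonneg _).trans hA
      positivity
    · rw [sub_self]
      exact supOpNorm_zero_le.trans (mul_nonneg hε₀.le (supOpNorm_nonneg _))
  · have hD1 : 1 ≤ D := le_trans (by exact_mod_cast hA0) hA
    obtain ⟨ω, hω⟩ := exists_signs_supOpNorm_le K hε₀ hε₁.le hD1 hA hB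
      (Nat.le_ceil (2 ^ 28 * D / ε ^ 2))
    refine ⟨krausCPMap (signedKraus K ω), ?_, ?_⟩
    · have h1 : (krausRank (krausMap (signedKraus K ω)) : ℝ) ≤ ⌈2 ^ 28 * D / ε ^ 2⌉₊ := by
        exact_mod_cast krausRank_krausMap_le (signedKraus K ω)
      have h2 := (Nat.ceil_lt_add_one (a := 2 ^ 28 * D / ε ^ 2) (by positivity)).le
      have h3 : 1 ≤ 2 ^ 28 * D / ε ^ 2 := by
        rw [le_div_iff₀ (by positivity)]
        nlinarith
      have h4 : 2 ^ 29 * D / ε ^ 2 = 2 ^ 28 * D / ε ^ 2 + 2 ^ 28 * D / ε ^ 2 := by ring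
      rw [h4]
      exact h1.trans (h2.trans (by linarith))
    · rw [hK]
      exact hω
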